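/- Let $S$ be a separable metrizable topological space and let $I=[0,\infty)$ or $I=[0,T]$ with $0<T<\infty$. Let $D(I;S)$ be the set of all càdlàg paths $\omega:I\to S$ (right continuous, with left limits in $S$), endowed with the Skorohod ($J_1$) topology and its Borel $\sigma$-algebra: if $d$ is any metric inducing the topology of $S$, then $\omega_n\to\omega$ if and only if for every $N>0$ there are increasing bijections $\theta_n:I\to I$ with $\sup_{t\in I,\,t\le N}|\theta_n(t)-t|\to0$ and $\sup_{t\in I,\,t\le N}d(\omega_n(t),\omega(\theta_n(t)))\to0$. A subset $A$ of a metrizable space $X$ is called analytic if it is analytic with respect to the paving of all Borel sets of $X$, i.e. if there are a compact metrizable space $E$, compact sets $K_{n,m}\subset E$ and Borel sets $B_{n,m}\subset X$ ($n,m\in\mathbb N$) such that $A$ is the projection to $X$ of $\bigcap_n\bigcup_m K_{n,m}\times B_{n,m}$. A co-analytic set is the complement of an analytic set. A metrizable co-Souslin space is a topological space that is homeomorphic to a co-analytic subset of a compact metrizable space. Proposition 7.1. (i) If $C$ is a co-analytic subset of $S$, then $D(I;C)$, the set of càdlàg paths in $C$ with respect to the relative topology on $C$ (so that left limits have to lie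 in $C$), regarded as a set of paths in $S$, is a co-analytic subset of $D(I;S)$. (ii) If $S$ is a metrizable co-Souslin space, then $D(I;S)$ is also a metrizable co-Souslin space. -/

import Mathlib

open Set Filter Topology TopologicalSpace MeasureTheory

universe u

/-- A subset `A` of a topological space `X` is *analytic* if it is analytic with respect to the
paving of all Borel sets of `X`: there are an auxiliary compact metrizable space `E` and a countable
intersection of countable unions of rectangles `K × B`, with `K ⊆ E` compact and `B ⊆ X` Borel,
whose projection to `X` is `A`. (Compact metrizable spaces have at most continuum many points, so
it is no restriction to take `E` in the lowest universe.) For spaces `X` that are not Souslin this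
is not Mathlib's `MeasureTheory.AnalyticSet`, under which `X` itself need not be analytic. -/
def IsBorelAnalytic {X : Type u} [TopologicalSpace X] (A : Set X) : Prop :=
  ∃ (E : Type) (_ : TopologicalSpace E) (_ : CompactSpace E) (_ : MetrizableSpace E)
    (K : ℕ → ℕ → Set E) (B : ℕ → ℕ → Set X),
    (∀ n m, IsCompact (K n m)) ∧ (∀ n m, MeasurableSet[borel X] (B n m)) ∧
      A = Prod.snd '' (⋂ n, ⋃ m, K n m ×ˢ B n m)

/-- A co-analytic set is the complement of an analytic set. -/
def IsBorelCoanalytic {X : Type u} [TopologicalSpace X] (A : Set X) : Prop :=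
  IsBorelAnalytic Aᶜ

/-- A *metrizable co-Souslin space* is a space which is homeomorphic to a co-analytic subset of
some compact metrizable space (which may be taken in the lowest universe, as every compact
metrizable space is homeomorphic to a subspace of the Hilbert cube). -/
def IsMetrizableCoSouslin (X : Type u) [TopologicalSpace X] : Prop :=
  ∃ (K : Type) (_ : TopologicalSpace K) (_ : CompactSpace K) (_ : MetrizableSpace K)
    (f : X → K), IsEmbedding f ∧ IsBorelCoanalytic (range f)

/-- The set `D(I; S)` of càdlàg paths from the time set `I` to `S`. At a point `t` without
predecessors in `I` (such as `t = 0`) the filter `𝓝[<] t` is `⊥`, so nothing is required of the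
left limit there; similarly for right continuity at the right end point of `I`. -/
@[ext]
structure SkorohodSpace (I : Set ℝ) (S : Type u) [TopologicalSpace S] where
  /-- the path -/
  toFun : I → S
  rightContinuous : ∀ t : I, ContinuousWithinAt toFun (Ioi t) t
  leftLimit : ∀ t : I, ∃ l : S, Tendsto toFun (𝓝[<] t) (𝓝 l)

namespace SkorohodSpace

/-- The basic neighbourhood of the path `x` with parameters `N` and `ε`: all paths `y` for which
there is a time change `θ` (an increasing bijection of `I`) with `|θ t - t| < ε` and
`dist (y t) (x (θ t)) < ε` for all `t ∈ I` with `t ≤ N`. -/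
def basicNhd {I : Set ℝ} {S : Type u} [MetricSpace S] (x : SkorohodSpace I S) (N ε : ℝ) :
    Set (SkorohodSpace I S) :=
  {y | ∃ θ : I ≃o I, ∀ t : I, (t : ℝ) ≤ N →
    |(θ t : ℝ) - (t : ℝ)| < ε ∧ dist (y.toFun t) (x.toFun (θ t)) < ε}

theorem basicNhd_mono {I : Set ℝ} {S : Type u} [MetricSpace S] (x : SkorohodSpace I S)
    {N N' ε ε' : ℝ} (hN : N' ≤ N) (hε : ε ≤ ε') : basicNhd x N ε ⊆ basicNhd x N' ε' := by
  rintro y ⟨θ, h⟩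
  exact ⟨θ, fun t ht => ⟨(h t (ht.trans hN)).1.trans_le hε, (h t (ht.trans hN)).2.trans_le hε⟩⟩

/-- The Skorohod (J₁) topology on `D(I; S)`: a set is open if with each path `x` it contains one of
the basic neighbourhoods of `x`. Thus `y n → x` if and only if for each `N` there are time changes
`θ n` with `sup_{t ≤ N} |θ n t - t| → 0` and `sup_{t ≤ N} dist (y n t) (x (θ n t)) → 0`. This
serves both for `I = [0, ∞)` and for `I = [0, T]`, where `t ≤ N` is no restriction once `N ≥ T`. -/
instance instTopologicalSpace {I : Set ℝ} {S : Type u} [MetricSpace S] :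
    TopologicalSpace (SkorohodSpace I S) where
  IsOpen U := ∀ x ∈ U, ∃ N ε : ℝ, 0 < ε ∧ basicNhd x N ε ⊆ U
  isOpen_univ := fun _ _ => ⟨0, 1, one_pos, subset_univ _⟩
  isOpen_inter := by
    rintro U V hU hV x ⟨hxU, hxV⟩
    obtain ⟨N, ε, hε, h⟩ := hU x hxU
    obtain ⟨N', ε', hε', h'⟩ := hV x hxV
    exact ⟨max N N', min ε ε', lt_min hε hε', subset_inter
      ((basicNhd_mono x (le_max_left _ _) (min_le_left _ _)).trans h)
      ((basicNhd_mono x (le_max_right _ _) (min_le_right _ _)).trans h')⟩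
  isOpen_sUnion := by
    rintro 𝒰 h𝒰 x ⟨U, hU, hx⟩
    obtain ⟨N, ε, hε, h⟩ := h𝒰 U hU x hx
    exact ⟨N, ε, hε, h.trans (subset_sUnion_of_mem hU)⟩

/-- The inclusion of `D(I; C)`, defined with respect to the relative topology on `C ⊆ S`,
in `D(I; S)`. -/
def inclusion {I : Set ℝ} {S : Type u} [TopologicalSpace S] (C : Set S)
    (x : SkorohodSpace I C) : SkorohodSpace I S where
  toFun t := (x.toFun t : S)
  rightContinuous t := continuous_subtype_val.continuousAt.comp_continuousWithinAt
    (x.rightContinuous t)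
  leftLimit t := by
    obtain ⟨l, hl⟩ := x.leftLimit t
    exact ⟨l, (continuous_subtype_val.tendsto l).comp hl⟩

end SkorohodSpace

/-!
Fix a countable set `Q` of times (the rational ones and the right end point of `I`), and map a path
`x` to its values at these times, read in a compact metrizable space `K` by an embedding
`f : S → K`. Let `L(C) ⊆ K ^ Q` be the set of those families that have, along `Q`, at each time a
right limit in `C` and at each time but the first a left limit in `C`. The whole theorem rests on the
following facts.

* If `C` is co-analytic in the compact space `K`, then so is `L(C)` in `K ^ Q`
  (`analyticSet_compl_limitsIn`): a family `z` is outside `L(C)` if for some `t` it is not Cauchy at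
  `t`, or has a limit outside `C` there. Both are countable conditions on `z`, `t` and the limit, so
  the complement is a projection of analytic sets.
* The sets that are analytic with respect to the paving of Borel sets are the preimages of analytic
  subsets of Polish spaces under Borel maps (`isBorelAnalytic_preimage`,
  `exists_analyticSet_preimage_eq`).
* The Skorohod space is metrizable and separable, and its Borel `σ`-algebra is the one pulled back
  from `K ^ Q` (`borel_eq_comap_gridValues`). Evaluations are Borel since the paths that are in a
  closed set at a given time form a `Gδ` set; and a path is the limit of its discretizations along
  grids contained in `Q`, which depend continuously on its values in `Q`.

For (i), `f` is an embedding in the Hilbert cube; with `C = f⁻¹(A')` for a co-analytic set `A'`, the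
set of paths in `C` is the preimage of `L(A')`. For (ii), `f` has co-analytic range and
the paths correspond exactly to `L(f(S))` (`range_gridValues`). If `g` embeds the Skorohod space in the
Hilbert cube, then `g` and the map to `K ^ Q` determine each other in a Borel way, so that there are
Borel maps `Ψ` from the cube to `K ^ Q` and `G` back for which the range of `g` consists of the
points `k` with `Ψ k ∈ L(f(S))` and `G (Ψ k) = k`; this set is co-analytic.
-/

/-! ### Analytic sets for the paving of Borel sets -/

/-- Preimages of analytic sets under Borel maps are analytic for the paving of Borel sets. If the
analytic set is the range of `f : (ℕ → ℕ) → Y`, a point `y` is `f σ` if and only if it is in the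
closure of the image of every cylinder around `σ`, which is a Souslin scheme. -/
theorem isBorelAnalytic_preimage {X : Type u} [TopologicalSpace X] {Y : Type*}
    [TopologicalSpace Y] [T3Space Y] [MeasurableSpace Y] [OpensMeasurableSpace Y] {φ : X → Y}
    (hφ : Measurable[borel X] φ) {A : Set Y} (hA : AnalyticSet A) : IsBorelAnalytic (φ ⁻¹' A) := by
  rw [AnalyticSet] at hA
  obtain rfl | ⟨f, hf, rfl⟩ := hA
  · exact ⟨Unit, inferInstance, inferInstance, inferInstance, fun _ _ => univ, fun _ _ => ∅,
      fun _ _ => isCompact_univ, fun _ _ => @MeasurableSet.empty X (borel X), by simp [iInter_const]⟩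
  have hs : ∀ n : ℕ, ∃ s : ℕ → Fin n → ℕ, Function.Surjective s := fun n =>
    exists_surjective_nat _
  choose s hs using hs
  -- The natural number `k` is coded by the indicator function of `{k}`, which turns `ℕ → ℕ` into a
  -- subset of the compact space `ℕ → ℕ → Bool`.
  let code : ℕ → ℕ → Bool := fun k j => decide (j = k)
  have hcode : Function.Injective code := fun a b hab => by
    simpa [code] using congrFun hab a
  refine ⟨ℕ → ℕ → Bool, inferInstance, inferInstance, inferInstance,
    fun n m => {e | ∀ i : Fin n, e i = code (s n m i)},
    fun n m => φ ⁻¹' closure (f '' {σ | ∀ i : Fin n, σ i = s n m i}), fun n m => ?_,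
    fun n m => hφ isClosed_closure.measurableSet, ?_⟩
  · simp only [Set.ofPred_forall]
    exact (isClosed_iInter fun i => isClosed_eq (continuous_apply _) continuous_const).isCompact
  ext x
  simp only [mem_preimage, mem_range, mem_image, mem_iInter, mem_iUnion, mem_prod, mem_ofPred_eq,
    Prod.exists, exists_eq_right]
  constructor
  · rintro ⟨σ, hσ⟩
    refine ⟨fun i => code (σ i), fun n => ?_⟩
    obtain ⟨m, hm⟩ := hs n (fun i => σ i)
    exact ⟨m, fun i => by rw [hm], subset_closure ⟨σ, fun i => by rw [hm], hσ⟩⟩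
  · rintro ⟨e, he⟩
    have : ∀ i : ℕ, ∃ k, e i = code k := fun i => by
      obtain ⟨m, hm, -⟩ := he (i + 1)
      exact ⟨_, hm ⟨i, i.lt_succ_self⟩⟩
    choose σ hσ using this
    refine ⟨σ, ?_⟩
    by_contra hne
    have hU : {φ x}ᶜ ∈ 𝓝 (f σ) := isOpen_compl_singleton.mem_nhds hne
    obtain ⟨F, ⟨hF, hFc⟩, hFx⟩ := (closed_nhds_basis (f σ)).mem_iff.1 hU
    obtain ⟨V, hV, hσV, hVF⟩ := (PiNat.isTopologicalBasis_cylinders fun _ : ℕ => ℕ).mem_nhds_iff.1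
      (hf.continuousAt hF)
    obtain ⟨τ, n, rfl⟩ := hV
    obtain ⟨m, hm, hx⟩ := he n
    refine hFx (closure_minimal ?_ hFc hx) rfl
    rintro _ ⟨ρ, hρ, rfl⟩
    refine hVF fun i hi => ?_
    have h1 : ρ i = σ i := by
      rw [hρ ⟨i, hi⟩]
      exact hcode ((hm ⟨i, hi⟩).symm.trans (hσ i))
    exact h1.trans (hσV i hi)

/-- Conversely, a set that is analytic for the paving of Borel sets is the preimage of an analytic set
under any inducing map to a Polish space, since the countably many Borel sets involved extend. -/
theorem exists_analyticSet_preimage_eq {X : Type u} [TopologicalSpace X] {Y : Type*}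
    [TopologicalSpace Y] [PolishSpace Y] {f : X → Y} (hf : IsInducing f) {A : Set X}
    (hA : IsBorelAnalytic A) : ∃ A' : Set Y, AnalyticSet A' ∧ f ⁻¹' A' = A := by
  obtain ⟨E, _, _, _, K, B, hK, hB, rfl⟩ := hA
  let := metrizableSpaceMetric E
  borelize E
  borelize Y
  have hB' : ∀ n m, ∃ B' : Set Y, MeasurableSet B' ∧ f ⁻¹' B' = B n m := fun n m => by
    have h := hB n m
    rwa [hf.eq_induced, borel_comap, ← BorelSpace.measurable_eq (α := Y)] at h
  choose B' hB' hBB' using hB'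
  refine ⟨Prod.snd '' (⋂ n, ⋃ m, K n m ×ˢ B' n m),
    (MeasurableSet.iInter fun n => .iUnion fun m =>
      (hK n m).measurableSet.prod (hB' n m)).analyticSet.image_of_continuous continuous_snd, ?_⟩
  ext x
  simp [← hBB']

theorem MeasureTheory.AnalyticSet.union {α : Type*} [TopologicalSpace α] {s t : Set α}
    (hs : AnalyticSet s) (ht : AnalyticSet t) : AnalyticSet (s ∪ t) := by
  rw [union_eq_iUnion]
  exact .iUnion fun b => by cases b <;> assumption

theorem MeasureTheory.AnalyticSet.inter {α : Type*} [TopologicalSpace α] [T2Space α]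
    {s t : Set α} (hs : AnalyticSet s) (ht : AnalyticSet t) : AnalyticSet (s ∩ t) := by
  rw [inter_eq_iInter]
  exact .iInter fun b => by cases b <;> assumption

/-- For filters `l t` on a countable set that depend measurably on the point `t` of a Polish space,
the families without limit in the co-analytic set `Aᶜ` along some `l t` form an analytic set. -/
theorem analyticSet_setOf_exists_not_tendsto {T Q K : Type*} [TopologicalSpace T] [PolishSpace T]
    [MeasurableSpace T] [BorelSpace T] [Countable Q] [TopologicalSpace K] [CompactSpace K]
    [MetrizableSpace K] {l : T → Filter Q} {W : ℕ → T → Set Q}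
    (hl : ∀ t, (l t).HasAntitoneBasis (W · t)) (hW : ∀ n q, MeasurableSet {t | q ∈ W n t})
    {T₀ : Set T} (hT₀ : MeasurableSet T₀) (hne : ∀ t ∈ T₀, (l t).NeBot) {A : Set K}
    (hA : AnalyticSet A) :
    AnalyticSet {z : Q → K | ∃ t ∈ T₀, ¬ ∃ h ∈ Aᶜ, Tendsto z (l t) (𝓝 h)} := by
  let := metrizableSpaceMetric K
  borelize K
  have hlim : ∀ (z : Q → K) (t : T) (h : K), Tendsto z (l t) (𝓝 h) ↔
      ∀ k : ℕ, ∃ j : ℕ, ∀ q, q ∈ W j t → dist (z q) h < 1 / (k + 1) := fun z t h => by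
    rw [(hl t).toHasBasis.tendsto_iff Metric.nhds_basis_ball_inv_nat_succ]
    simp [Metric.mem_ball]
  have hcau : ∀ (z : Q → K), ∀ t ∈ T₀, (∃ h, Tendsto z (l t) (𝓝 h)) ↔
      ∀ k : ℕ, ∃ j : ℕ, ∀ q q', q ∈ W j t → q' ∈ W j t → dist (z q) (z q') < 1 / (k + 1) :=
    fun z t ht => by
    have := hne t ht
    rw [← cauchy_map_iff_exists_tendsto, cauchy_map_iff, and_iff_right this,
      ((hl t).prod (hl t)).toHasBasis.tendsto_iff Metric.uniformity_basis_dist_inv_nat_succ]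
    simp
  have hset : {z : Q → K | ∃ t ∈ T₀, ¬ ∃ h ∈ Aᶜ, Tendsto z (l t) (𝓝 h)} =
      Prod.fst '' {p : (Q → K) × T | p.2 ∈ T₀ ∧ ¬ ∀ k : ℕ, ∃ j : ℕ, ∀ q q', q ∈ W j p.2 →
        q' ∈ W j p.2 → dist (p.1 q) (p.1 q') < 1 / (k + 1)} ∪
      Prod.fst '' ({p : (Q → K) × T × K | p.2.1 ∈ T₀ ∧ ∀ k : ℕ, ∃ j : ℕ, ∀ q, q ∈ W j p.2.1 →
        dist (p.1 q) p.2.2 < 1 / (k + 1)} ∩ (fun p => p.2.2) ⁻¹' A) := by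
    ext z
    simp only [mem_union, mem_image, mem_inter_iff, Prod.exists, exists_and_right, exists_eq_right,
      mem_ofPred_eq, mem_preimage]
    constructor
    · rintro ⟨t, ht, h⟩
      by_cases hc : ∃ h, Tendsto z (l t) (𝓝 h)
      · obtain ⟨c, hc⟩ := hc
        refine Or.inr ⟨t, c, ⟨ht, (hlim _ _ _).1 hc⟩, ?_⟩
        by_contra hcA
        exact h ⟨c, hcA, hc⟩
      · exact Or.inl ⟨t, ht, fun h => hc ((hcau z t ht).2 h)⟩
    · rintro (⟨t, ht, h⟩ | ⟨t, c, ⟨ht, h⟩, hcA⟩)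
      · exact ⟨t, ht, fun ⟨c, _, hc⟩ => h ((hcau z t ht).1 ⟨c, hc⟩)⟩
      · refine ⟨t, ht, fun ⟨c', hcA', hc'⟩ => hcA' ?_⟩
        have := hne t ht
        rwa [← tendsto_nhds_unique ((hlim _ _ _).2 h) hc']
  rw [hset]
  have hW' : ∀ n q, Measurable fun t => q ∈ W n t := fun n q => measurableSet_setOfPred.1 (hW n q)
  have hT₀' : Measurable fun t => t ∈ T₀ := measurableSet_setOfPred.1 hT₀
  refine AnalyticSet.union ?_ ?_
  · refine (MeasurableSet.analyticSet (measurableSet_setOfPred.2 ?_)).image_of_continuous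
      continuous_fst
    refine (hT₀'.comp measurable_snd).and (Measurable.not ?_)
    refine Measurable.forall fun k => Measurable.exists fun j => Measurable.forall fun q =>
      Measurable.forall fun q' => Measurable.imp ((hW' j q).comp measurable_snd) <|
        Measurable.imp ((hW' j q').comp measurable_snd) ?_
    refine measurableSet_setOfPred.1 (measurableSet_lt ?_ measurable_const)
    fun_prop
  · refine ((MeasurableSet.analyticSet (measurableSet_setOfPred.2 ?_)).inter
      (hA.preimage (by fun_prop))).image_of_continuous continuous_fst
    refine ((hT₀'.comp (measurable_fst.comp measurable_snd))).and ?_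
    refine Measurable.forall fun k => Measurable.exists fun j => Measurable.forall fun q =>
      Measurable.imp ((hW' j q).comp (measurable_fst.comp measurable_snd)) ?_
    refine measurableSet_setOfPred.1 (measurableSet_lt ?_ measurable_const)
    fun_prop

/-! ### Metrizability of the Skorohod topology and measurability of evaluations -/

namespace SkorohodSpace

variable {I : Set ℝ} {S : Type u} [MetricSpace S]

theorem isOpen_iff {U : Set (SkorohodSpace I S)} :
    IsOpen U ↔ ∀ x ∈ U, ∃ N ε : ℝ, 0 < ε ∧ basicNhd x N ε ⊆ U :=
  Iff.rfl

/-- A time change controlled up to time `N` has an inverse controlled up to time `N - ε`. -/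
theorem orderIso_symm_le [I.OrdConnected] (h0 : IsLeast I 0) {θ : I ≃o I} {N ε : ℝ} (hN : 0 ≤ N)
    (h : ∀ t : I, (t : ℝ) ≤ N → |(θ t : ℝ) - t| < ε) {s : I} (hs : s + ε ≤ N) :
    (θ.symm s : ℝ) ≤ N := by
  by_contra! hlt
  have hNI : N ∈ I := OrdConnected.out ‹_› h0.1 (θ.symm s).2 ⟨hN, hlt.le⟩
  have h1 : θ ⟨N, hNI⟩ < s := by
    rw [← θ.lt_symm_apply]
    exact hlt
  have h2 := (abs_lt.1 (h ⟨N, hNI⟩ le_rfl)).1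
  have h3 : (θ ⟨N, hNI⟩ : ℝ) < s := h1
  simp only at h2
  linarith

theorem mem_basicNhd_symm [I.OrdConnected] (h0 : IsLeast I 0) {x y : SkorohodSpace I S}
    {N ε : ℝ} (hN : 0 ≤ N) (h : y ∈ basicNhd x N ε) : x ∈ basicNhd y (N - ε) ε := by
  obtain ⟨θ, hθ⟩ := h
  refine ⟨θ.symm, fun s hs => ?_⟩
  obtain ⟨h1, h2⟩ := hθ (θ.symm s)
    (orderIso_symm_le h0 hN (fun t ht => (hθ t ht).1) (by linarith))
  rw [θ.apply_symm_apply] at h1 h2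
  exact ⟨by rwa [abs_sub_comm], by rwa [dist_comm]⟩

theorem mem_basicNhd_trans {x y z : SkorohodSpace I S} {N δ ε : ℝ} (hxy : y ∈ basicNhd x (N + ε) δ)
    (hyz : z ∈ basicNhd y N ε) : z ∈ basicNhd x N (δ + ε) := by
  obtain ⟨θ, hθ⟩ := hxy
  obtain ⟨η, hη⟩ := hyz
  refine ⟨η.trans θ, fun t ht => ?_⟩
  obtain ⟨h1, h2⟩ := hη t ht
  obtain ⟨h3, h4⟩ := hθ (η t) (by linarith [(abs_lt.1 h1).2])
  refine ⟨?_, ?_⟩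
  · simp only [OrderIso.trans_apply]
    linarith [abs_sub_le (θ (η t) : ℝ) (η t) t]
  · simp only [OrderIso.trans_apply]
    linarith [dist_triangle (z.toFun t) (y.toFun (η t)) (x.toFun (θ (η t)))]

theorem self_mem_basicNhd (x : SkorohodSpace I S) (N : ℝ) {ε : ℝ} (hε : 0 < ε) :
    x ∈ basicNhd x N ε :=
  ⟨OrderIso.refl I, fun t _ => by simpa⟩

/-- The entourages of a uniform structure inducing the Skorohod topology. -/
def entourage (I : Set ℝ) (S : Type u) [MetricSpace S] (n : ℕ) :
    Set (SkorohodSpace I S × SkorohodSpace I S) :=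
  {p | p.2 ∈ basicNhd p.1 n (1 / (n + 1))}

theorem entourage_antitone : Antitone (entourage I S) := fun m n hmn p hp =>
  basicNhd_mono p.1 (by exact_mod_cast hmn) (Nat.one_div_le_one_div hmn) hp

theorem hasBasis_iInf_entourage :
    (⨅ n, 𝓟 (entourage I S n)).HasBasis (fun _ => True) (entourage I S) :=
  hasBasis_iInf_principal entourage_antitone.directed_ge

/-- The Skorohod topology comes from a uniform structure with countably many basic entourages. -/
@[reducible]
def uniformSpace [I.OrdConnected] (h0 : IsLeast I 0) (S : Type u) [MetricSpace S] :
    UniformSpace (SkorohodSpace I S) :=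
  .ofCoreEq
    { uniformity := ⨅ n, 𝓟 (entourage I S n)
      refl := by
        refine hasBasis_iInf_entourage.ge_iff.2 fun n _ => ?_
        rintro ⟨x, y⟩ rfl
        exact self_mem_basicNhd x _ Nat.one_div_pos_of_nat
      symm := by
        refine (hasBasis_iInf_entourage.tendsto_iff hasBasis_iInf_entourage).2 fun n _ =>
          ⟨n + 1, trivial, fun p hp => ?_⟩
        refine basicNhd_mono _ ?_ (Nat.one_div_le_one_div n.le_succ)
          (mem_basicNhd_symm h0 (Nat.cast_nonneg _) hp)
        have : (1 : ℝ) / ((n + 1 : ℕ) + 1) ≤ 1 := by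
          rw [div_le_one (by positivity)]
          simp only [Nat.cast_add, Nat.cast_one]
          linarith [n.cast_nonneg (α := ℝ)]
        push_cast at this ⊢
        linarith
      comp := by
        refine ((hasBasis_iInf_entourage.lift' (monotone_id.relComp monotone_id)).le_basis_iff
          hasBasis_iInf_entourage).2 fun n _ => ⟨2 * n + 1, trivial, ?_⟩
        rintro ⟨x, z⟩ ⟨y, hxy, hyz⟩
        have h1 : (1 : ℝ) / ((2 * n + 1 : ℕ) + 1) ≤ 1 := by
          rw [div_le_one (by positivity)]
          push_cast
          linarith [n.cast_nonneg (α := ℝ)]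
        have h2 : (1 : ℝ) / ((2 * n + 1 : ℕ) + 1) + 1 / ((2 * n + 1 : ℕ) + 1) = 1 / (n + 1) := by
          push_cast
          field_simp
          ring
        have hn : (0 : ℝ) ≤ n := n.cast_nonneg
        change z ∈ basicNhd x n (1 / (n + 1))
        rw [← h2]
        refine mem_basicNhd_trans (basicNhd_mono x ?_ le_rfl hxy) (basicNhd_mono y ?_ le_rfl hyz)
        · push_cast at h1 ⊢
          linarith
        · push_cast
          linarith }
    instTopologicalSpace <| by
      refine TopologicalSpace.ext (funext fun U => propext (forall₂_congr fun x _ => ?_))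
      change (∃ N ε : ℝ, 0 < ε ∧ basicNhd x N ε ⊆ U) ↔
        U ∈ comap (Prod.mk x) (⨅ n, 𝓟 (entourage I S n))
      rw [(hasBasis_iInf_entourage.comap _).mem_iff]
      constructor
      · rintro ⟨N, ε, hε, h⟩
        obtain ⟨m, hm⟩ := exists_nat_ge N
        obtain ⟨n, hn⟩ := exists_nat_one_div_lt hε
        refine ⟨max m n, trivial, (basicNhd_mono x ?_ ?_).trans h⟩
        · exact hm.trans (by exact_mod_cast le_max_left _ _)
        · exact (Nat.one_div_le_one_div (le_max_right _ _)).trans hn.le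
      · rintro ⟨n, -, h⟩
        exact ⟨n, 1 / (n + 1), Nat.one_div_pos_of_nat, h⟩

theorem pseudoMetrizableSpace [I.OrdConnected] (h0 : IsLeast I 0) :
    PseudoMetrizableSpace (SkorohodSpace I S) := by
  let := uniformSpace h0 S
  have : (uniformity (SkorohodSpace I S)).IsCountablyGenerated :=
    hasBasis_iInf_entourage.isCountablyGenerated
  exact inferInstance

theorem hasBasis_nhds [I.OrdConnected] (h0 : IsLeast I 0) (x : SkorohodSpace I S) :
    (𝓝 x).HasBasis (fun _ : ℕ => True) (fun n => basicNhd x n (1 / (n + 1))) := by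
  let := uniformSpace h0 S
  rw [nhds_eq_comap_uniformity]
  exact hasBasis_iInf_entourage.comap _

theorem isOpen_setOf_exists_mem [I.OrdConnected] (h0 : IsLeast I 0) {J : Set I} (hJ : IsOpen J)
    {U : Set S} (hU : IsOpen U) :
    IsOpen {x : SkorohodSpace I S | ∃ s ∈ J, x.toFun s ∈ U} := by
  rw [isOpen_iff]
  rintro x ⟨s, hsJ, hsU⟩
  obtain ⟨δ, hδ, hJ⟩ := Metric.isOpen_iff.1 hJ s hsJ
  obtain ⟨ε, hε, hU⟩ := Metric.isOpen_iff.1 hU _ hsU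
  have hs0 : (0 : ℝ) ≤ s := h0.2 s.2
  refine ⟨s + min δ ε, min δ ε, lt_min hδ hε, ?_⟩
  rintro y ⟨θ, hθ⟩
  obtain ⟨h1, h2⟩ := hθ (θ.symm s)
    (orderIso_symm_le h0 (by positivity) (fun t ht => (hθ t ht).1) le_rfl)
  rw [θ.apply_symm_apply] at h1 h2
  refine ⟨θ.symm s, hJ ?_, hU ?_⟩
  · rw [Metric.mem_ball, dist_comm, Subtype.dist_eq, Real.dist_eq]
    exact h1.trans_le (min_le_left _ _)
  · exact h2.trans_le (min_le_right _ _)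

/-- The preimage of a closed set under an evaluation map is a `Gδ` set. Evaluation at the right end
point is continuous; at the other times, a right continuous path is in a closed set `F` at time `t`
if and only if it visits every neighbourhood of `F` immediately after time `t`. -/
theorem isGδ_preimage_eval [I.OrdConnected] (h0 : IsLeast I 0) (t : I) {F : Set S}
    (hF : IsClosed F) : IsGδ {x : SkorohodSpace I S | x.toFun t ∈ F} := by
  by_cases ht : IsTop t
  · have : IsOpen {x : SkorohodSpace I S | x.toFun t ∈ F}ᶜ := by
      rw [isOpen_iff]
      intro x hx
      obtain ⟨ε, hε, hU⟩ := Metric.isOpen_iff.1 hF.isOpen_compl _ hx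
      refine ⟨t, ε, hε, ?_⟩
      rintro y ⟨θ, hθ⟩
      have hθt : θ t = t := le_antisymm (ht _) (by simpa using θ.monotone (ht (θ.symm t)))
      exact hU (by simpa [hθt] using (hθ t le_rfl).2)
    have h1 : IsClosed {x : SkorohodSpace I S | x.toFun t ∈ F} := ⟨this⟩
    have := pseudoMetrizableSpace (S := S) h0
    let := pseudoMetrizableSpacePseudoMetric (SkorohodSpace I S)
    exact h1.isGδ
  · have hne : (𝓝[>] t).NeBot := by
      obtain ⟨b, hb⟩ := not_forall.1 ht
      exact nhdsGT_neBot_of_exists_gt ⟨b, not_le.1 hb⟩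
    have : {x : SkorohodSpace I S | x.toFun t ∈ F} = ⋂ (k : ℕ) (j : ℕ), {x | ∃ s ∈
        Ioi t ∩ Metric.ball t (1 / (j + 1)), x.toFun s ∈ Metric.thickening (1 / (k + 1)) F} := by
      ext x
      simp only [mem_ofPred_eq, mem_iInter]
      constructor
      · intro h k j
        have h1 : Metric.thickening (1 / ((k : ℝ) + 1)) F ∈ 𝓝 (x.toFun t) :=
          Metric.isOpen_thickening.mem_nhds
            (Metric.self_subset_thickening Nat.one_div_pos_of_nat F h)
        have h2 : ∀ᶠ s in 𝓝[>] t, s ∈ Metric.ball t (1 / ((j : ℝ) + 1)) :=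
          mem_nhdsWithin_of_mem_nhds (Metric.ball_mem_nhds _ Nat.one_div_pos_of_nat)
        obtain ⟨s, ⟨hs1, hs2⟩, hs3⟩ :=
          (((x.rightContinuous t).eventually h1).and h2 |>.and self_mem_nhdsWithin).exists
        exact ⟨s, ⟨hs3, hs2⟩, hs1⟩
      · intro h
        rw [← hF.closure_eq, Metric.closure_eq_iInter_cthickening]
        simp only [mem_iInter]
        intro δ hδ
        obtain ⟨k, hk⟩ := exists_nat_one_div_lt hδ
        have h1 : ∃ᶠ s in 𝓝[>] t, x.toFun s ∈ Metric.cthickening δ F := by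
          rw [(nhdsWithin_hasBasis Metric.nhds_basis_ball_inv_nat_succ _).frequently_iff]
          intro j _
          obtain ⟨s, ⟨hs1, hs2⟩, hs3⟩ := h k j
          exact ⟨s, ⟨hs2, hs1⟩, Metric.thickening_subset_cthickening_of_le hk.le F hs3⟩
        exact Metric.isClosed_cthickening.mem_of_frequently_of_tendsto h1 (x.rightContinuous t)
    rw [this]
    exact .iInter fun k => .iInter fun j => (isOpen_setOf_exists_mem h0
      (isOpen_Ioi.inter Metric.isOpen_ball) Metric.isOpen_thickening).isGδ

theorem measurable_eval [I.OrdConnected] (h0 : IsLeast I 0) [MeasurableSpace S] [BorelSpace S]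
    (t : I) : Measurable[borel (SkorohodSpace I S)] fun x : SkorohodSpace I S => x.toFun t := by
  borelize (SkorohodSpace I S)
  exact measurable_of_isClosed fun F hF => (isGδ_preimage_eval h0 t hF).measurableSet

theorem metrizableSpace [I.OrdConnected] (h0 : IsLeast I 0) :
    MetrizableSpace (SkorohodSpace I S) := by
  have := pseudoMetrizableSpace (S := S) h0
  have : T0Space (SkorohodSpace I S) := by
    refine ⟨fun x y hxy => SkorohodSpace.ext (funext fun t => ?_)⟩
    obtain ⟨𝒰, h𝒰, -, h⟩ := isGδ_preimage_eval (S := S) h0 t (isClosed_singleton (x := x.toFun t))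
    have hx : x ∈ ⋂₀ 𝒰 := h ▸ rfl
    have hy : y ∈ ⋂₀ 𝒰 := fun U hU => (hxy.mem_open_iff (h𝒰 U hU)).1 (hx U hU)
    rw [← h] at hy
    exact (mem_singleton_iff.1 hy).symm
  let := pseudoMetrizableSpacePseudoMetric (SkorohodSpace I S)
  let := MetricSpace.ofT0PseudoMetricSpace (SkorohodSpace I S)
  infer_instance

/-! ### Approximation of paths along grids -/

/-- The countable set of times that consists of the rational elements of `I` and of the right end
point of `I`, if there is one. -/
def gridTimes (I : Set ℝ) : Set I :=
  {t | IsTop t ∨ ∃ r : ℚ, (r : ℝ) = t}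

theorem countable_gridTimes : (gridTimes I).Countable := by
  refine Countable.union ?_ ?_
  · exact Set.Subsingleton.countable fun a ha b hb => le_antisymm (hb a) (ha b)
  · exact (countable_range ((↑) : ℚ → ℝ)).preimage Subtype.val_injective

instance : Countable (gridTimes I) := countable_gridTimes.to_subtype

open scoped Classical in
/-- The last multiple of `1 / (n + 1)` up to the time `t`, except that the right end point of `I`
is left where it is. -/
noncomputable def floorTime [I.OrdConnected] (h0 : IsLeast I 0) (n : ℕ) (t : I) : gridTimes I :=
  if h : IsTop t then ⟨t, .inl h⟩ else
    ⟨⟨⌊(n + 1 : ℝ) * t⌋ / (n + 1), OrdConnected.out ‹_› h0.1 t.2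
      ⟨div_nonneg (Int.cast_nonneg (Int.floor_nonneg.2 (mul_nonneg (by positivity) (h0.2 t.2))))
        (by positivity),
      (div_le_iff₀' (by positivity)).2 (Int.floor_le _)⟩⟩,
      .inr ⟨⌊(n + 1 : ℝ) * t⌋ / (n + 1), by push_cast; rfl⟩⟩

theorem not_isTop_of_lt {s t : I} (h : s < t) : ¬ IsTop s := fun hs => h.not_ge (hs t)

section FloorTime

variable [I.OrdConnected] (h0 : IsLeast I 0) {n : ℕ} {s t : I}

theorem floorTime_of_isTop (ht : IsTop t) : (floorTime h0 n t : I) = t := by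
  simp [floorTime, ht]

theorem coe_floorTime_of_not_isTop (ht : ¬ IsTop t) :
    ((floorTime h0 n t : I) : ℝ) = ⌊(n + 1 : ℝ) * t⌋ / (n + 1) := by
  simp [floorTime, ht]

theorem floorTime_le : (floorTime h0 n t : I) ≤ t := by
  by_cases ht : IsTop t
  · exact (floorTime_of_isTop h0 ht).le
  · rw [← Subtype.coe_le_coe, coe_floorTime_of_not_isTop h0 ht, div_le_iff₀' (by positivity)]
    exact Int.floor_le _

theorem floorTime_congr (hs : ¬ IsTop s) (ht : ¬ IsTop t)
    (h : ⌊(n + 1 : ℝ) * s⌋ = ⌊(n + 1 : ℝ) * t⌋) : floorTime h0 n s = floorTime h0 n t := by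
  refine Subtype.ext (Subtype.ext ?_)
  rw [coe_floorTime_of_not_isTop h0 hs, coe_floorTime_of_not_isTop h0 ht, h]

theorem eventually_floorTime_eq (n : ℕ) (t : I) :
    ∀ᶠ s in 𝓝[>] t, floorTime h0 n s = floorTime h0 n t := by
  by_cases ht : IsTop t
  · have : Ioi t = ∅ := by
      ext s
      simpa using ht s
    simp [this]
  obtain ⟨b, hb⟩ := not_forall.1 ht
  have h1 : ∀ᶠ s in 𝓝[>] t, s < b :=
    mem_nhdsWithin_of_mem_nhds (Iio_mem_nhds (not_le.1 hb))
  have h2 : Tendsto (fun s : I => (n + 1 : ℝ) * s) (𝓝[>] t) (𝓝[≥] ((n + 1 : ℝ) * t)) := by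
    refine tendsto_nhdsWithin_iff.2 ⟨?_, ?_⟩
    · exact (Continuous.tendsto (by fun_prop) t).mono_left nhdsWithin_le_nhds
    · filter_upwards [self_mem_nhdsWithin] with s hs
      have hs : (t : ℝ) < s := hs
      exact mul_le_mul_of_nonneg_left hs.le (by positivity)
  filter_upwards [h1, h2.eventually (tendsto_pure.1 (tendsto_floor_right_pure_floor _))]
    with s hs hs'
  exact floorTime_congr h0 (not_isTop_of_lt hs) ht hs'

theorem exists_eventually_floorTime_eq (n : ℕ) (t : I) :
    ∃ q, ∀ᶠ s in 𝓝[<] t, floorTime h0 n s = q := by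
  rcases (𝓝[<] t).eq_or_neBot with hbot | hbot
  · exact ⟨floorTime h0 n t, by simp [hbot]⟩
  have h2 : Tendsto (fun s : I => (n + 1 : ℝ) * s) (𝓝[<] t) (𝓝[<] ((n + 1 : ℝ) * t)) := by
    refine tendsto_nhdsWithin_iff.2 ⟨?_, ?_⟩
    · exact (Continuous.tendsto (by fun_prop) t).mono_left nhdsWithin_le_nhds
    · filter_upwards [self_mem_nhdsWithin] with s hs
      have hs : (s : ℝ) < t := hs
      exact mul_lt_mul_of_pos_left hs (by positivity)
  have h3 := (h2.eventually (tendsto_pure.1 (tendsto_floor_left_pure_ceil_sub_one _))).and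
    self_mem_nhdsWithin
  obtain ⟨s₀, h4, h5⟩ := h3.exists
  refine ⟨floorTime h0 n s₀, ?_⟩
  filter_upwards [h3] with s hs
  exact floorTime_congr h0 (not_isTop_of_lt hs.2) (not_isTop_of_lt h5) (hs.1.trans h4.symm)

theorem finite_image_floorTime (n : ℕ) (N : ℝ) :
    (floorTime h0 n '' {t | (t : ℝ) ≤ N}).Finite := by
  have h1 : {t : I | IsTop t}.Finite :=
    Set.Subsingleton.finite fun a ha b hb => le_antisymm (hb a) (ha b)
  have h2 : ((fun m : ℤ => (m : ℝ) / (n + 1)) '' Icc 0 ⌊(n + 1 : ℝ) * N⌋).Finite :=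
    (finite_Icc _ _).image _
  refine ((h1.image (floorTime h0 n)).union
    (h2.preimage (Subtype.val_injective.comp Subtype.val_injective).injOn)).subset ?_
  rintro _ ⟨t, ht, rfl⟩
  by_cases htop : IsTop t
  · exact .inl ⟨t, htop, rfl⟩
  · refine .inr ⟨⌊(n + 1 : ℝ) * t⌋, ⟨?_, ?_⟩, (coe_floorTime_of_not_isTop h0 htop).symm⟩
    · exact Int.floor_nonneg.2 (mul_nonneg (by positivity) (h0.2 t.2))
    · exact Int.floor_le_floor (mul_le_mul_of_nonneg_left ht (by positivity))

/-- For every time `c` there is a point `d` of the `n`-th grid just after `c` such that the times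
from `d` on are those that are rounded down to a time from `c` on. -/
theorem eventually_exists_le_floorTime_iff (c : I) : ∀ᶠ n : ℕ in atTop, ∃ d : ℝ,
    c ≤ d ∧ d ≤ c + 1 / (n + 1) ∧ (IsTop c → d = c) ∧
      ∀ t : I, d ≤ t ↔ c ≤ (floorTime h0 n t : I) := by
  by_cases hc : IsTop c
  · refine .of_forall fun n => ⟨c, le_rfl, ?_, fun _ => rfl, fun t => ⟨fun h => ?_, fun h => ?_⟩⟩
    · linarith [Nat.one_div_pos_of_nat (α := ℝ) (n := n)]
    · have : IsTop t := fun s => (hc s).trans h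
      rwa [floorTime_of_isTop h0 this]
    · exact h.trans (floorTime_le h0)
  · obtain ⟨b, hb⟩ := not_forall.1 hc
    have hb : (c : ℝ) < b := not_le.1 hb
    filter_upwards [(tendsto_one_div_add_atTop_nhds_zero_nat (𝕜 := ℝ)).eventually_lt_const
      (sub_pos.2 hb)] with n hn
    have hn0 : (0 : ℝ) < n + 1 := by positivity
    have hd : (⌈(n + 1 : ℝ) * c⌉ : ℝ) / (n + 1) ≤ c + 1 / (n + 1) := by
      have h : ((c : ℝ) + 1 / (n + 1)) * (n + 1) = (n + 1) * c + 1 := by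
        field_simp
      rw [div_le_iff₀ hn0, h]
      exact (Int.ceil_lt_add_one _).le
    refine ⟨⌈(n + 1 : ℝ) * c⌉ / (n + 1), (le_div_iff₀' hn0).2 (Int.le_ceil _), hd,
      fun h => absurd h hc, fun t => ?_⟩
    by_cases ht : IsTop t
    · rw [floorTime_of_isTop h0 ht]
      have : (b : ℝ) ≤ t := ht b
      exact iff_of_true (by linarith) (ht c)
    · rw [← Subtype.coe_le_coe, coe_floorTime_of_not_isTop h0 ht, le_div_iff₀' hn0,
        div_le_iff₀' hn0, ← Int.ceil_le, Int.le_floor]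

end FloorTime

/-- The path that takes the value `v q` from the point `q` of the `n`-th grid up to the next one. -/
noncomputable def stepPath [I.OrdConnected] (h0 : IsLeast I 0) (n : ℕ) (v : gridTimes I → S) :
    SkorohodSpace I S where
  toFun t := v (floorTime h0 n t)
  rightContinuous t := by
    refine tendsto_const_nhds.congr' ?_
    filter_upwards [eventually_floorTime_eq h0 n t] with s hs
    rw [hs]
  leftLimit t := by
    obtain ⟨q, hq⟩ := exists_eventually_floorTime_eq h0 n t
    refine ⟨v q, tendsto_const_nhds.congr' ?_⟩
    filter_upwards [hq] with s hs
    rw [hs]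

theorem continuous_stepPath [I.OrdConnected] (h0 : IsLeast I 0) (n : ℕ) :
    Continuous (stepPath h0 n : (gridTimes I → S) → SkorohodSpace I S) := by
  refine continuous_iff_continuousAt.2 fun v =>
    (hasBasis_nhds h0 _).tendsto_right_iff.2 fun k _ => ?_
  have : ∀ᶠ w in 𝓝 v, ∀ q ∈ floorTime h0 n '' {t | (t : ℝ) ≤ k},
      dist (w q) (v q) < 1 / (k + 1) :=
    (eventually_all_finite (finite_image_floorTime h0 n k)).2 fun q _ =>
      (continuous_apply q).tendsto v (Metric.ball_mem_nhds _ Nat.one_div_pos_of_nat)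
  filter_upwards [this] with w hw
  refine ⟨OrderIso.refl I, fun t ht => ⟨?_, hw _ (mem_image_of_mem _ ht)⟩⟩
  simpa using Nat.cast_add_one_pos k

/-- The times `a < b` are at distance less than `ε`, and the path `x` oscillates by less than `ε`
on `[a, b)`. -/
def SmallOn (x : SkorohodSpace I S) (ε : ℝ) (a b : I) : Prop :=
  a < b ∧ (b : ℝ) - a < ε ∧ ∀ s ∈ Ico a b, ∀ t ∈ Ico a b, dist (x.toFun s) (x.toFun t) < ε

/-- A càdlàg path has only finitely many large jumps up to any time `c`: there is a partition of
`[0, c)` into finitely many intervals on which the path is almost constant. -/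
theorem reflTransGen_smallOn [I.OrdConnected] (h0 : IsLeast I 0) (x : SkorohodSpace I S)
    {ε : ℝ} (hε : 0 < ε) (c : I) : Relation.ReflTransGen (SmallOn x ε) ⟨0, h0.1⟩ c := by
  let A : Set ℝ := {a | a ≤ c ∧ ∃ h : a ∈ I, Relation.ReflTransGen (SmallOn x ε) ⟨0, h0.1⟩ ⟨a, h⟩}
  have h0A : (0 : ℝ) ∈ A := ⟨h0.2 c.2, h0.1, .refl⟩
  have hA : BddAbove A := ⟨c, fun a ha => ha.1⟩
  have hsI : sSup A ∈ I := OrdConnected.out ‹_› h0.1 c.2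
    ⟨le_csSup hA h0A, csSup_le ⟨0, h0A⟩ fun a ha => ha.1⟩
  obtain ⟨t, ht⟩ : ∃ t : I, (t : ℝ) = sSup A := ⟨⟨_, hsI⟩, rfl⟩
  have htc : t ≤ c := by
    rw [← Subtype.coe_le_coe, ht]
    exact csSup_le ⟨0, h0A⟩ fun a ha => ha.1
  have hmem : Relation.ReflTransGen (SmallOn x ε) ⟨0, h0.1⟩ t := by
    rcases (show (⟨0, h0.1⟩ : I) ≤ t from h0.2 t.2).eq_or_lt with h | h
    · rw [h]
    obtain ⟨l, hl⟩ := x.leftLimit t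
    have h1 : ∀ᶠ s : I in 𝓝[<] t, (t : ℝ) - s < ε := by
      refine mem_nhdsWithin_of_mem_nhds
        (ContinuousAt.eventually_lt (f := fun s : I => (t : ℝ) - s) (by fun_prop)
          continuousAt_const ?_)
      simpa
    obtain ⟨b, hb, hbt⟩ := (mem_nhdsLT_iff_exists_Ioo_subset' h).1
      ((hl.eventually (Metric.ball_mem_nhds l (half_pos hε))).and h1)
    obtain ⟨a, ⟨hac, haI, ha⟩, hba⟩ := exists_lt_of_lt_csSup ⟨0, h0A⟩
      (show (b : ℝ) < sSup A from ht ▸ hb)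
    have hat : (⟨a, haI⟩ : I) ≤ t := by
      rw [← Subtype.coe_le_coe, ht]
      exact le_csSup hA ⟨hac, haI, ha⟩
    rcases hat.eq_or_lt with h | h
    · rwa [← h]
    · refine ha.tail ⟨h, (hbt ⟨hba, h⟩).2, fun s hs s' hs' => ?_⟩
      have h3 := (hbt ⟨lt_of_lt_of_le hba hs.1, hs.2⟩).1
      have h4 := (hbt ⟨lt_of_lt_of_le hba hs'.1, hs'.2⟩).1
      linarith [dist_triangle_right (x.toFun s) (x.toFun s') l]
  rcases htc.eq_or_lt with h | h
  · rwa [← h]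
  have h1 : ∀ᶠ s : I in 𝓝[>] t, (s : ℝ) - t < ε := by
    refine mem_nhdsWithin_of_mem_nhds
      (ContinuousAt.eventually_lt (f := fun s : I => (s : ℝ) - t) (by fun_prop)
        continuousAt_const ?_)
    simpa
  obtain ⟨b, hb, hbt⟩ := (mem_nhdsGT_iff_exists_Ioo_subset' h).1
    (((x.rightContinuous t).eventually (Metric.ball_mem_nhds _ (half_pos hε))).and h1)
  obtain ⟨a, hta, hab⟩ := exists_between (lt_min hb h)
  have hsmall : ∀ s ∈ Ico t a, dist (x.toFun s) (x.toFun t) < ε / 2 := fun s hs => by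
    rcases hs.1.eq_or_lt with h | h
    · rw [h, dist_self]
      exact half_pos hε
    · exact (hbt ⟨h, hs.2.trans (hab.trans_le (min_le_left _ _))⟩).1
  have : Relation.ReflTransGen (SmallOn x ε) ⟨0, h0.1⟩ a := by
    refine hmem.tail ⟨hta, (hbt ⟨hta, hab.trans_le (min_le_left _ _)⟩).2, fun s hs s' hs' => ?_⟩
    linarith [dist_triangle_right (x.toFun s) (x.toFun s') (x.toFun t), hsmall s hs, hsmall s' hs']
  have : (a : ℝ) ≤ t := ht ▸ le_csSup hA ⟨(hab.le.trans (min_le_right _ _) : a ≤ c), a.2, this⟩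
  exact absurd this (not_le.2 hta)

theorem exists_orderIso_eqOn_Iic {c d e : ℝ} (hd : c < d) (he : c < e) :
    ∃ η : ℝ ≃o ℝ, (∀ s ≤ c, η s = s) ∧ η d = e := by
  let r := (e - c) / (d - c)
  have hr : 0 < r := div_pos (sub_pos.2 he) (sub_pos.2 hd)
  let f : ℝ → ℝ := fun s => if s ≤ c then s else c + r * (s - c)
  have hf1 : ∀ s ≤ c, f s = s := fun s hs => if_pos hs
  have hf2 : ∀ s, c < s → f s = c + r * (s - c) := fun s hs => if_neg hs.not_ge
  have hmono : StrictMono f := by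
    intro s t hst
    rcases le_or_gt t c with ht | ht
    · rwa [hf1 t ht, hf1 s (hst.le.trans ht)]
    · rw [hf2 t ht]
      rcases le_or_gt s c with hs | hs
      · rw [hf1 s hs]
        nlinarith [mul_pos hr (sub_pos.2 ht)]
      · rw [hf2 s hs]
        nlinarith [mul_pos hr (sub_pos.2 hst)]
  have hsurj : Function.Surjective f := by
    intro t
    rcases le_or_gt t c with ht | ht
    · exact ⟨t, hf1 t ht⟩
    · refine ⟨c + (t - c) / r, ?_⟩
      rw [hf2 _ (by linarith [div_pos (sub_pos.2 ht) hr])]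
      field_simp
      ring
  refine ⟨hmono.orderIsoOfSurjective f hsurj, hf1, (hf2 d hd).trans ?_⟩
  have : d - c ≠ 0 := (sub_pos.2 hd).ne'
  simp only [r]
  field_simp
  ring

/-- The time change that moves the points of a partition to the grid is built interval by interval:
the one for `[0, c)` is followed by a map which fixes the times before `c`. -/
theorem eventually_exists_orderIso [I.OrdConnected] (h0 : IsLeast I 0) {x : SkorohodSpace I S}
    {ε : ℝ} (hε : 0 < ε) {c : I} (hc : Relation.ReflTransGen (SmallOn x ε) ⟨0, h0.1⟩ c) :
    ∀ᶠ n : ℕ in atTop, ∃ (d : ℝ) (θ : ℝ ≃o ℝ), c ≤ d ∧ d ≤ c + 1 / (n + 1) ∧ (IsTop c → d = c) ∧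
      (∀ t : I, d ≤ t ↔ c ≤ (floorTime h0 n t : I)) ∧ θ 0 = 0 ∧ θ d = c ∧
      ∀ t u : I, θ t = u → t < d →
        |(u : ℝ) - t| < 2 * ε ∧ dist (x.toFun (floorTime h0 n t)) (x.toFun u) < ε := by
  induction hc with
  | refl =>
    refine .of_forall fun n => ⟨0, OrderIso.refl ℝ, le_rfl, ?_, fun _ => rfl, fun t => ?_, rfl, rfl,
      fun t u _ ht => absurd (h0.2 t.2) ht.not_ge⟩
    · simpa using Nat.cast_add_one_pos n |>.le
    · exact iff_of_true (h0.2 t.2) (h0.2 (floorTime h0 n t).1.2)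
  | @tail c c' _ hcc' ih =>
    obtain ⟨hlt, hdiff, hosc⟩ := hcc'
    have hlt' : (c : ℝ) < c' := hlt
    have hlim := tendsto_one_div_add_atTop_nhds_zero_nat (𝕜 := ℝ)
    filter_upwards [ih, eventually_exists_le_floorTime_iff h0 c',
      hlim.eventually_lt_const (sub_pos.2 hlt'), hlim.eventually_lt_const hε]
    rintro n ⟨d, θ, hcd, hdc, -, hiff, hθ0, hθd, hθ⟩ ⟨d', hcd', hdc', htop', hiff'⟩ hn1 hn2
    have hdd' : d < d' := by linarith
    obtain ⟨η, hη, hηd⟩ := exists_orderIso_eqOn_Iic (hθd ▸ θ.strictMono hdd' : (c : ℝ) < θ d') hlt'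
    refine ⟨d', θ.trans η, hcd', hdc', htop', hiff', ?_, hηd, fun t u htu ht => ?_⟩
    · rw [OrderIso.trans_apply, hθ0, hη 0 (h0.2 c.2)]
    rw [OrderIso.trans_apply] at htu
    rcases lt_or_ge (t : ℝ) d with htd | htd
    · have : θ t < c := hθd ▸ θ.strictMono htd
      rw [hη _ this.le] at htu
      exact hθ t u htu htd
    · have hu1 : (c : ℝ) ≤ u := by
        rw [← htu, ← hη c le_rfl, ← hθd]
        exact η.monotone (θ.monotone htd)
      have hu2 : (u : ℝ) < c' := by
        rw [← htu, ← hηd]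
        exact η.strictMono (θ.strictMono ht)
      refine ⟨abs_lt.2 ⟨by linarith, by linarith⟩, hosc _ ⟨(hiff t).1 htd, ?_⟩ _ ⟨hu1, hu2⟩⟩
      exact not_le.1 fun h => ht.not_ge ((hiff' t).2 h)

/-- The discretizations of a path along the grids converge to the path. -/
theorem tendsto_stepPath [I.OrdConnected] (h0 : IsLeast I 0)
    (hI : I = Ici 0 ∨ ∃ T : ℝ, 0 < T ∧ I = Icc 0 T) (x : SkorohodSpace I S) :
    Tendsto (fun n => stepPath h0 n fun q => x.toFun q) atTop (𝓝 x) := by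
  refine (hasBasis_nhds h0 x).tendsto_right_iff.2 fun k _ => ?_
  have hk : (0 : ℝ) < 1 / (k + 1) := Nat.one_div_pos_of_nat
  set ε : ℝ := 1 / (k + 1)
  obtain ⟨c, hc⟩ : ∃ c : I, IsTop c ∨ I = Ici 0 ∧ (k : ℝ) < c := by
    rcases hI with rfl | ⟨T, hT, rfl⟩
    · exact ⟨⟨k + 1, by simp only [mem_Ici]; positivity⟩, .inr ⟨rfl, by simp⟩⟩
    · exact ⟨⟨T, hT.le, le_rfl⟩, .inl fun t => t.2.2⟩
  filter_upwards [eventually_exists_orderIso h0 (half_pos hk)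
    (reflTransGen_smallOn h0 x (half_pos hk) c)]
  rintro n ⟨d, θ, hcd, -, htop, -, hθ0, hθd, hθ⟩
  have hθI : ∀ t : ℝ, t ∈ I ↔ θ t ∈ I := by
    have h1 : ∀ t, 0 ≤ θ t ↔ 0 ≤ t := fun t => by
      rw [← θ.le_iff_le (x := 0) (y := t), hθ0]
    intro t
    rcases hc with hc | ⟨rfl, -⟩
    · have hIc : I = Icc 0 (c : ℝ) := by
        ext s
        exact ⟨fun hs => ⟨h0.2 hs, hc ⟨s, hs⟩⟩, fun hs => OrdConnected.out ‹_› h0.1 c.2 hs⟩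
      rw [htop hc] at hθd
      have h2 : θ t ≤ c ↔ t ≤ c := by
        rw [← θ.le_iff_le (x := t), hθd]
      rw [hIc, mem_Icc, mem_Icc, h1, h2]
    · exact (h1 t).symm
  let θI : I ≃o I := ⟨θ.toEquiv.subtypeEquiv hθI, θ.le_iff_le⟩
  refine ⟨θI, fun t ht => ?_⟩
  rcases lt_or_ge (t : ℝ) d with htd | htd
  · obtain ⟨h1, h2⟩ := hθ t (θI t) rfl htd
    exact ⟨by linarith, by change dist (x.toFun (floorTime h0 n t)) _ < ε; linarith⟩
  · rcases hc with hc | ⟨-, hc⟩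
    · -- here `t` is the right end point of `I`, which is fixed by the time change and by rounding
      have htc : t = c := le_antisymm (hc t) (hcd.trans htd)
      subst htc
      rw [htop hc] at hθd
      have : θI t = t := Subtype.ext hθd
      rw [this, sub_self, abs_zero]
      refine ⟨hk, ?_⟩
      change dist (x.toFun (floorTime h0 n t)) _ < ε
      rwa [floorTime_of_isTop h0 hc, dist_self]
    · linarith

/-- The discretizations of all paths form a separable dense set. -/
theorem separableSpace [SeparableSpace S] [I.OrdConnected] (h0 : IsLeast I 0)
    (hI : I = Ici 0 ∨ ∃ T : ℝ, 0 < T ∧ I = Icc 0 T) : SeparableSpace (SkorohodSpace I S) := by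
  have := metrizableSpace (S := S) h0
  let := metrizableSpaceMetric (SkorohodSpace I S)
  have h : IsSeparable (⋃ n, range (stepPath (S := S) h0 n)) :=
    isSeparable_iUnion.2 fun n => isSeparable_range (continuous_stepPath h0 n)
  refine isSeparable_univ_iff.1 (h.closure.mono fun x _ => ?_)
  exact mem_closure_of_tendsto (tendsto_stepPath h0 hI x)
    (.of_forall fun n => mem_iUnion.2 ⟨n, mem_range_self _⟩)

/-- The family of the values of a path at the grid times, mapped to a space `K`. -/
def gridValues {K : Type*} (f : S → K) (x : SkorohodSpace I S) (q : gridTimes I) : K :=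
  f (x.toFun q)

/-- The Borel `σ`-algebra of the Skorohod space is generated by the evaluations at the grid times: the
identity is the pointwise limit of the discretizations, which are measurable for the `σ`-algebra
generated in this way. -/
theorem borel_eq_comap_gridValues [SeparableSpace S] [I.OrdConnected] (h0 : IsLeast I 0)
    (hI : I = Ici 0 ∨ ∃ T : ℝ, 0 < T ∧ I = Icc 0 T) {K : Type*} [TopologicalSpace K] {f : S → K}
    (hf : IsInducing f) :
    borel (SkorohodSpace I S) = (borel (gridTimes I → K)).comap (gridValues f) := by
  have := metrizableSpace (S := S) h0
  have := UniformSpace.secondCountable_of_separable S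
  borelize S
  have h1 : (borel (gridTimes I → K)).comap (gridValues (I := I) f) =
      MeasurableSpace.pi.comap (gridValues (K := S) id) := by
    rw [(Pi.borelSpace : BorelSpace (gridTimes I → S)).measurable_eq, (IsInducing.piMap fun _ => hf).eq_induced, borel_comap, MeasurableSpace.comap_comp]
    rfl
  rw [h1]
  refine le_antisymm ?_ ?_
  · let m : MeasurableSpace (SkorohodSpace I S) := MeasurableSpace.pi.comap (gridValues id)
    have : @Measurable _ _ m (borel _) (id : SkorohodSpace I S → SkorohodSpace I S) := by
      let mb : MeasurableSpace (SkorohodSpace I S) := borel _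
      have : @BorelSpace _ _ mb := ⟨rfl⟩
      refine @measurable_of_tendsto_metrizable _ _ m _ _ mb _
        (fun n x => stepPath h0 n (gridValues id x)) _ (fun n => ?_)
        (tendsto_pi_nhds.2 fun x => tendsto_stepPath h0 hI x)
      exact (continuous_stepPath h0 n).measurable.comp (comap_measurable _)
    exact fun s hs => this hs
  · rw [← measurable_iff_comap_le]
    exact @measurable_pi_lambda _ _ _ (borel _) _ _ fun q => measurable_eval h0 q.1

/-! ### Families of values that come from paths -/

variable {K : Type*} [TopologicalSpace K]

/-- The filter of grid times that approach `t` from the right; the time `t` itself is included. -/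
def gridRight (t : I) : Filter (gridTimes I) :=
  comap Subtype.val (𝓝[≥] t)

/-- The filter of grid times that approach `t` strictly from the left. -/
def gridLeft (t : I) : Filter (gridTimes I) :=
  comap Subtype.val (𝓝[<] t)

theorem exists_gridTime_between [I.OrdConnected] {a b : I} (h : a < b) :
    ∃ q : gridTimes I, a < q.1 ∧ q.1 < b := by
  obtain ⟨r, har, hrb⟩ := exists_rat_btwn (Subtype.coe_lt_coe.2 h)
  exact ⟨⟨⟨r, OrdConnected.out ‹_› a.2 b.2 ⟨har.le, hrb.le⟩⟩, .inr ⟨r, rfl⟩⟩, har, hrb⟩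

theorem gridRight_neBot [I.OrdConnected] (t : I) : (gridRight t).NeBot := by
  refine comap_neBot_iff.2 fun m hm => ?_
  by_cases ht : IsTop t
  · exact ⟨⟨t, .inl ht⟩, mem_of_mem_nhdsWithin self_mem_Ici hm⟩
  · obtain ⟨b, hb⟩ := not_forall.1 ht
    obtain ⟨c, hc, hcm⟩ := (mem_nhdsGT_iff_exists_Ioo_subset' (not_le.1 hb)).1
      (nhdsWithin_mono t Ioi_subset_Ici_self hm)
    obtain ⟨q, hq⟩ := exists_gridTime_between hc
    exact ⟨q, hcm hq⟩

theorem gridLeft_neBot [I.OrdConnected] {s t : I} (hst : s < t) : (gridLeft t).NeBot := by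
  refine comap_neBot_iff.2 fun m hm => ?_
  obtain ⟨c, hc, hcm⟩ := (mem_nhdsLT_iff_exists_Ioo_subset' hst).1 hm
  obtain ⟨q, hq⟩ := exists_gridTime_between hc
  exact ⟨q, hcm hq⟩

theorem hasAntitoneBasis_comap_nhdsWithin (s : Set I) (t : I) :
    (comap (Subtype.val : gridTimes I → I) (𝓝[s] t)).HasAntitoneBasis
      fun n : ℕ => {q | dist q.1 t < 1 / (n + 1) ∧ q.1 ∈ s} where
  toHasBasis := (nhdsWithin_hasBasis Metric.nhds_basis_ball_inv_nat_succ s).comap _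
  antitone _ _ hmn _ hq := ⟨hq.1.trans_le (Nat.one_div_le_one_div hmn), hq.2⟩

/-- The families indexed by the grid times which have at each time a right limit in `C`, and a left
limit in `C` at each time but the initial one. -/
def limitsIn (I : Set ℝ) (C : Set K) : Set (gridTimes I → K) :=
  {z | (∀ t : I, ∃ h ∈ C, Tendsto z (gridRight t) (𝓝 h)) ∧
    ∀ t : I, (∃ s, s < t) → ∃ h ∈ C, Tendsto z (gridLeft t) (𝓝 h)}

theorem analyticSet_compl_limitsIn [I.OrdConnected] [PolishSpace I] [CompactSpace K]
    [MetrizableSpace K] {A : Set K} (hA : AnalyticSet A) : AnalyticSet (limitsIn I Aᶜ)ᶜ := by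
  have h1 := analyticSet_setOf_exists_not_tendsto (T := I)
    (fun t => hasAntitoneBasis_comap_nhdsWithin (Ici t) t)
    (fun n q => ((isOpen_lt (f := fun t : I => dist q.1 t) (by fun_prop)
      continuous_const).measurableSet).inter measurableSet_Iic)
    MeasurableSet.univ (fun t _ => gridRight_neBot t) hA
  have h2 := analyticSet_setOf_exists_not_tendsto (T := I)
    (fun t => hasAntitoneBasis_comap_nhdsWithin (Iio t) t)
    (fun n q => ((isOpen_lt (f := fun t : I => dist q.1 t) (by fun_prop)
      continuous_const).measurableSet).inter measurableSet_Ioi)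
    (T₀ := {t | ∃ s, s < t})
    (by
      rw [ofPred_exists]
      exact (isOpen_iUnion fun s => isOpen_Ioi).measurableSet)
    (fun t ⟨_, ht⟩ => gridLeft_neBot ht) hA
  convert h1.union h2 using 1
  ext z
  simp only [limitsIn, gridRight, gridLeft, mem_compl_iff, mem_ofPred_eq, mem_union, mem_univ,
    true_and, not_and_or, not_forall, exists_prop]

theorem tendsto_gridValues_gridRight {f : S → K} (hf : Continuous f) (x : SkorohodSpace I S)
    (t : I) : Tendsto (gridValues f x) (gridRight t) (𝓝 (f (x.toFun t))) :=
  (hf.tendsto _).comp <|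
    (continuousWithinAt_Ioi_iff_Ici.1 (x.rightContinuous t)).tendsto.comp tendsto_comap

theorem tendsto_gridValues_gridLeft {f : S → K} (hf : Continuous f) {x : SkorohodSpace I S}
    {t : I} {l : S} (hl : Tendsto x.toFun (𝓝[<] t) (𝓝 l)) :
    Tendsto (gridValues f x) (gridLeft t) (𝓝 (f l)) :=
  (hf.tendsto _).comp <| hl.comp tendsto_comap

theorem gridValues_mem_limitsIn [I.OrdConnected] [T2Space K] {f : S → K} (hf : Continuous f)
    {x : SkorohodSpace I S} {C : Set K} : gridValues f x ∈ limitsIn I C ↔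
      (∀ t, f (x.toFun t) ∈ C) ∧
        ∀ t l, (∃ s, s < t) → Tendsto x.toFun (𝓝[<] t) (𝓝 l) → f l ∈ C := by
  constructor
  · rintro ⟨h1, h2⟩
    refine ⟨fun t => ?_, fun t l ht hl => ?_⟩
    · obtain ⟨h, hC, hh⟩ := h1 t
      have := gridRight_neBot t
      rwa [tendsto_nhds_unique (tendsto_gridValues_gridRight hf x t) hh]
    · obtain ⟨h, hC, hh⟩ := h2 t ht
      have := gridLeft_neBot ht.choose_spec
      rwa [tendsto_nhds_unique (tendsto_gridValues_gridLeft hf hl) hh]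
  · rintro ⟨h1, h2⟩
    refine ⟨fun t => ⟨_, h1 t, tendsto_gridValues_gridRight hf x t⟩, fun t ht => ?_⟩
    obtain ⟨l, hl⟩ := x.leftLimit t
    exact ⟨_, h2 t l ht hl, tendsto_gridValues_gridLeft hf hl⟩

/-- One-sided limits along the grid times are inherited by the function of the right limits. -/
theorem tendsto_of_tendsto_gridRight [I.OrdConnected] [T3Space K] {z : gridTimes I → K}
    {y : I → K} (hy : ∀ t, Tendsto z (gridRight t) (𝓝 (y t))) {U : Set I} (hU : IsOpen U) {t : I}
    {h : K} (hz : Tendsto z (comap Subtype.val (𝓝[U] t)) (𝓝 h)) :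
    Tendsto y (𝓝[U] t) (𝓝 h) := by
  refine (closed_nhds_basis h).tendsto_right_iff.2 fun F ⟨hF, hFc⟩ => ?_
  have h1 : ∀ᶠ s in 𝓝[U] t, ∀ q : gridTimes I, q.1 = s → z q ∈ F := by
    obtain ⟨V, hV, hVF⟩ := mem_comap.1 (hz hF)
    filter_upwards [hV] with s hs q hq
    exact hVF (by rwa [mem_preimage, hq])
  filter_upwards [eventually_eventually_nhdsWithin.2 h1, self_mem_nhdsWithin] with s hs hsU
  rw [hU.nhdsWithin_eq hsU] at hs
  have := gridRight_neBot s
  refine hFc.mem_of_tendsto (hy s) ?_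
  have h2 : ∀ᶠ q in gridRight s, ∀ q' : gridTimes I, q'.1 = q.1 → z q' ∈ F :=
    tendsto_comap.eventually (nhdsWithin_le_nhds hs)
  exact h2.mono fun q hq => hq q rfl

theorem range_gridValues [I.OrdConnected] [T3Space K] {f : S → K} (hf : IsEmbedding f) :
    range (gridValues (I := I) f) = limitsIn I (range f) := by
  refine Subset.antisymm ?_ ?_
  · rintro _ ⟨x, rfl⟩
    exact (gridValues_mem_limitsIn hf.continuous).2 ⟨fun t => ⟨_, rfl⟩, fun t l _ _ => ⟨_, rfl⟩⟩
  rintro z ⟨hR, hL⟩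
  have : ∀ t : I, ∃ s, Tendsto z (gridRight t) (𝓝 (f s)) := fun t => by
    obtain ⟨_, ⟨s, rfl⟩, hs⟩ := hR t
    exact ⟨s, hs⟩
  choose y hy using this
  refine ⟨⟨y, fun t => ?_, fun t => ?_⟩, funext fun q => ?_⟩
  · refine hf.tendsto_nhds_iff.2 (tendsto_of_tendsto_gridRight hy isOpen_Ioi ?_)
    exact (hy t).mono_left (comap_mono (nhdsWithin_mono t Ioi_subset_Ici_self))
  · by_cases ht : ∃ s, s < t
    · obtain ⟨_, ⟨l, rfl⟩, hl⟩ := hL t ht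
      exact ⟨l, hf.tendsto_nhds_iff.2 (tendsto_of_tendsto_gridRight hy isOpen_Iio hl)⟩
    · have : Iio t = ∅ := eq_empty_of_forall_notMem fun s hs => ht ⟨s, hs⟩
      exact ⟨y t, by simp [this]⟩
  · have h1 : pure q ≤ gridRight q.1 :=
      (map_le_iff_le_comap).1 (by rw [map_pure]; exact pure_le_nhdsWithin self_mem_Ici)
    exact tendsto_nhds_unique ((hy q.1).mono_left h1) (tendsto_pure_nhds z q)

theorem measurable_gridValues [SeparableSpace S] [I.OrdConnected] (h0 : IsLeast I 0)
    (hI : I = Ici 0 ∨ ∃ T : ℝ, 0 < T ∧ I = Icc 0 T) {f : S → K} (hf : IsInducing f) :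
    Measurable[borel _, borel _] (gridValues (I := I) f) :=
  @Measurable.of_comap_le _ _ (borel _) (borel _) _ (borel_eq_comap_gridValues h0 hI hf).ge

theorem mem_range_inclusion_iff [I.OrdConnected] {C : Set S} {x : SkorohodSpace I S} :
    x ∈ range (inclusion C) ↔ (∀ t, x.toFun t ∈ C) ∧
      ∀ t l, (∃ s, s < t) → Tendsto x.toFun (𝓝[<] t) (𝓝 l) → l ∈ C := by
  constructor
  · rintro ⟨y, rfl⟩
    refine ⟨fun t => (y.toFun t).2, fun t l ⟨s, hst⟩ hl => ?_⟩
    obtain ⟨l', hl'⟩ := y.leftLimit t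
    have := nhdsLT_neBot_of_exists_lt ⟨s, hst⟩
    rw [tendsto_nhds_unique hl ((continuous_subtype_val.tendsto l').comp hl')]
    exact l'.2
  · rintro ⟨h1, h2⟩
    refine ⟨⟨fun t => ⟨x.toFun t, h1 t⟩, fun t => tendsto_subtype_rng.2 (x.rightContinuous t),
      fun t => ?_⟩, rfl⟩
    by_cases ht : ∃ s, s < t
    · obtain ⟨l, hl⟩ := x.leftLimit t
      exact ⟨⟨l, h2 t l ht hl⟩, tendsto_subtype_rng.2 hl⟩
    · have : Iio t = ∅ := eq_empty_of_forall_notMem fun s hs => ht ⟨s, hs⟩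
      exact ⟨⟨x.toFun t, h1 t⟩, by simp [this]⟩

theorem isBorelCoanalytic_range_inclusion [SeparableSpace S] [I.OrdConnected] [PolishSpace I]
    (h0 : IsLeast I 0) (hI : I = Ici 0 ∨ ∃ T : ℝ, 0 < T ∧ I = Icc 0 T) {C : Set S}
    (hC : IsBorelCoanalytic C) :
    IsBorelCoanalytic (range (inclusion C : SkorohodSpace I C → SkorohodSpace I S)) := by
  obtain ⟨f, hf⟩ := Metric.PiNatEmbed.exists_embedding_to_hilbert_cube (X := S)
  obtain ⟨A, hA, hAC⟩ := exists_analyticSet_preimage_eq hf.isInducing hC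
  have hfC : ∀ s, f s ∈ Aᶜ ↔ s ∈ C := fun s => by
    rw [mem_compl_iff, ← mem_preimage, hAC, mem_compl_iff, not_not]
  have : (range (inclusion C : SkorohodSpace I C → SkorohodSpace I S))ᶜ =
      gridValues f ⁻¹' (limitsIn I Aᶜ)ᶜ := by
    ext x
    rw [mem_compl_iff, mem_preimage, mem_compl_iff, gridValues_mem_limitsIn hf.continuous,
      mem_range_inclusion_iff]
    simp only [hfC]
  rw [IsBorelCoanalytic, this]
  borelize (gridTimes I → ℕ → unitInterval)
  exact isBorelAnalytic_preimage (measurable_gridValues h0 hI hf.isInducing)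
    (analyticSet_compl_limitsIn hA)

theorem isMetrizableCoSouslin [SeparableSpace S] [I.OrdConnected] [PolishSpace I]
    (h0 : IsLeast I 0) (hI : I = Ici 0 ∨ ∃ T : ℝ, 0 < T ∧ I = Icc 0 T)
    (hS : IsMetrizableCoSouslin S) : IsMetrizableCoSouslin (SkorohodSpace I S) := by
  obtain ⟨K, _, _, _, f, hf, hfK⟩ := hS
  have := metrizableSpace (S := S) h0
  have := separableSpace (S := S) h0 hI
  obtain ⟨g, hg⟩ : ∃ g : SkorohodSpace I S → ℕ → unitInterval, IsEmbedding g := by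
    let := metrizableSpaceMetric (SkorohodSpace I S)
    exact Metric.PiNatEmbed.exists_embedding_to_hilbert_cube
  refine ⟨_, inferInstance, inferInstance, inferInstance, g, hg, ?_⟩
  have : PolishSpace K := by
    let := metrizableSpaceMetric K
    infer_instance
  obtain ⟨A, hA, hAf⟩ := exists_analyticSet_preimage_eq IsInducing.id hfK
  rw [preimage_id] at hAf
  subst hAf
  have hlim := analyticSet_compl_limitsIn (I := I) hA
  rw [compl_compl, ← range_gridValues hf] at hlim
  rw [IsBorelCoanalytic]
  borelize (ℕ → unitInterval)
  borelize (gridTimes I → K)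
  -- the extension of Borel maps below needs a nonempty target
  rcases isEmpty_or_nonempty (SkorohodSpace I S) with hE | ⟨⟨x₀⟩⟩
  · rw [range_eq_empty, compl_empty]
    exact isBorelAnalytic_preimage (φ := id) (@measurable_id _ (borel _))
      MeasurableSet.univ.analyticSet
  have : Nonempty (gridTimes I → K) := ⟨gridValues f x₀⟩
  have hgb : borel (SkorohodSpace I S) = MeasurableSpace.comap g inferInstance := by
    rw [hg.eq_induced, borel_comap]
  have hψb : borel (SkorohodSpace I S) = MeasurableSpace.comap (gridValues f) inferInstance := by
    rw [borel_eq_comap_gridValues h0 hI hf.isInducing]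
  obtain ⟨G, hG, hGg⟩ := Measurable.exists_eq_measurable_comp (f := gridValues f) (g := g)
    (by rw [← hψb, hgb]; exact comap_measurable g)
  obtain ⟨Ψ, hΨ, hΨg⟩ := Measurable.exists_eq_measurable_comp (f := g) (g := gridValues (I := I) f)
    (by rw [← hgb, hψb]; exact comap_measurable _)
  -- `Ψ k` comes from a path `x` and `G (Ψ k) = k` together say that `k = g x`
  have hset : (range g)ᶜ = (fun k => (Ψ k, k)) ⁻¹'
      (Prod.fst ⁻¹' (range (gridValues f))ᶜ ∪ {p | G p.1 = p.2}ᶜ) := by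
    ext k
    simp only [mem_compl_iff, mem_preimage, mem_union, mem_ofPred_eq, ← not_and_or, not_iff_not]
    constructor
    · rintro ⟨x, rfl⟩
      have h1 : Ψ (g x) = gridValues f x := (congrFun hΨg x).symm
      exact ⟨⟨x, h1.symm⟩, by rw [h1]; exact (congrFun hGg x).symm⟩
    · rintro ⟨⟨x, hx⟩, hk⟩
      exact ⟨x, by rw [← hk, ← hx]; exact congrFun hGg x⟩
  rw [hset]
  refine isBorelAnalytic_preimage ?_ ((hlim.preimage continuous_fst).union
    (measurableSet_eq_fun (hG.comp measurable_fst) measurable_snd).compl.analyticSet)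
  rw [← BorelSpace.measurable_eq]
  exact hΨ.prodMk measurable_id

end SkorohodSpace

theorem proposition7p1 {S : Type u} [MetricSpace S] [SeparableSpace S] (I : Set ℝ)
    (hI : I = Ici 0 ∨ ∃ T : ℝ, 0 < T ∧ I = Icc 0 T) :
    (∀ C : Set S, IsBorelCoanalytic C →
      IsBorelCoanalytic (range (SkorohodSpace.inclusion C : SkorohodSpace I C → SkorohodSpace I S)))
    ∧ (IsMetrizableCoSouslin S →
      MetrizableSpace (SkorohodSpace I S) ∧ IsMetrizableCoSouslin (SkorohodSpace I S)) := by
  have h : I.OrdConnected ∧ IsLeast I 0 ∧ IsClosed I := by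
    rcases hI with rfl | ⟨T, hT, rfl⟩
    · exact ⟨ordConnected_Ici, isLeast_Ici, isClosed_Ici⟩
    · exact ⟨ordConnected_Icc, isLeast_Icc hT.le, isClosed_Icc⟩
  obtain ⟨_, h0, hclosed⟩ := h
  have := hclosed.polishSpace
  exact ⟨fun C hC => SkorohodSpace.isBorelCoanalytic_range_inclusion h0 hI hC,
    fun hS => ⟨SkorohodSpace.metrizableSpace h0, SkorohodSpace.isMetrizableCoSouslin h0 hI hS⟩⟩
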